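/- Let $(\Omega,\mathscr F,P)$ be a probability space with a filtration $\mathbb F=(\mathscr F_t)_{t\ge 0}$ satisfying the usual conditions (right-continuity and completeness), and let $\mathscr T$ be the set of its stopping times with values in $[0,\infty]$. Let $(\pi^0_t)_{t\ge0}$, $(\pi^F_t)_{t\ge0}$, $(\pi^B_t)_{t\ge0}$ be real processes (the revenues of a firm $i\in\{1,2\}$ while nobody has invested, while only its opponent has invested, and once both have invested) that are product-measurable and $P\otimes dt$-integrable, such that the random variables $\int_0^t\pi^m_s\,ds$, $m=0,F,B$, are $\mathscr F_t$-measurable for every $t\ge0$, and such that $\pi^0\ge\pi^F$ holds $P\otimes dt$-a.e. Inequalities between random variables are understood $P$-a.s. For $\tau\in\mathscr T$ define the simultaneous-investment and follower payoffs \[ M(\tau)=\int_0^\tau\pi^0_s\,ds+E\Bigl[\int_\tau^\infty\pi^B_s\,ds\Bigm|\mathscr F_\tau\Bigr],\qquad F(\tau)=\int_0^\tau\pi^0_s\,ds+\operatorname*{ess\,sup}_{\tau'\in\mathscr T,\ \tau'\ge\tau}E\Bigl[\int_\tau^{\tau'}\pi^F_s\,ds+\int_{\tau'}^\infty\pi^B_s\,ds\Bigm|\mathscr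 F_\tau\Bigr], \] and let $\tau_F(\tau)$ be the latest stopping time $\tau'\ge\tau$ attaining the essential supremum in $F(\tau)$, i.e. the ($P$-a.s. unique) one that is $P$-a.s. not exceeded by any other such stopping time. Fix $\vartheta\in\mathscr T$ and consider the problems \[ (\mathrm S)\quad \operatorname*{ess\,sup}_{\tau\in\mathscr T,\ \tau\ge\vartheta}E\bigl[M(\tau)\bigm|\mathscr F_\vartheta\bigr]=\operatorname*{ess\,sup}_{\tau\in\mathscr T,\ \tau\ge\vartheta}E\Bigl[\int_0^\tau\pi^0_s\,ds+\int_\tau^\infty\pi^B_s\,ds\Bigm|\mathscr F_\vartheta\Bigr],\qquad (\mathrm F)\quad \operatorname*{ess\,sup}_{\tau\in\mathscr T,\ \tau\ge\vartheta}E\bigl[F(\tau)\bigm|\mathscr F_\vartheta\bigr]. \] Then the equality in $(\mathrm S)$ holds, and: 1. Every stopping time $\tau_M\ge\vartheta$ that attains $(\mathrm S)$ also attains $(\mathrm F)$. 2. If a stopping time $\tau_M\ge\vartheta$ attains $(\mathrm F)$, then $\tau_F(\tau_M)$ exists and attains $(\mathrm S)$. 3. Both problems have a latest solution (a stopping time that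 attains the problem and is $P$-a.s. not exceeded by any other stopping time that attains it), and the latest solutions of $(\mathrm S)$ and $(\mathrm F)$ agree. -/

import Mathlib

open MeasureTheory
open scoped NNReal

namespace InvestmentTiming

/-- Lebesgue measure `dt` on the time axis `[0, ∞)`. -/
noncomputable def timeMeasure : Measure ℝ≥0 :=
  (volume : Measure ℝ).comap ((↑) : ℝ≥0 → ℝ)

theorem measurableEmbedding_coe_nnreal : MeasurableEmbedding ((↑) : ℝ≥0 → ℝ) :=
  MeasurableEmbedding.subtype_coe (s := Set.Ici (0 : ℝ)) measurableSet_Ici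

theorem timeMeasure_Ioc (a b : ℝ≥0) :
    timeMeasure (Set.Ioc a b) = ENNReal.ofReal ((b : ℝ) - a) := by
  have himg : ((↑) : ℝ≥0 → ℝ) '' Set.Ioc a b = Set.Ioc (a : ℝ) b := by
    ext x
    simp only [Set.mem_image, Set.mem_Ioc]
    constructor
    · rintro ⟨y, ⟨h1, h2⟩, rfl⟩
      exact ⟨NNReal.coe_lt_coe.2 h1, NNReal.coe_le_coe.2 h2⟩
    · rintro ⟨h1, h2⟩
      exact ⟨⟨x, a.2.trans h1.le⟩, ⟨NNReal.coe_lt_coe.1 h1, NNReal.coe_le_coe.1 h2⟩, rfl⟩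
  rw [timeMeasure, measurableEmbedding_coe_nnreal.comap_apply, himg, Real.volume_Ioc]

instance instSigmaFiniteTimeMeasure : SigmaFinite timeMeasure := by
  have h : SigmaFinite (timeMeasure.map ((↑) : ℝ≥0 → ℝ)) := by
    rw [timeMeasure, measurableEmbedding_coe_nnreal.map_comap]
    infer_instance
  exact SigmaFinite.of_map timeMeasure measurableEmbedding_coe_nnreal.measurable.aemeasurable h

section Basic

variable {Ω : Type*} {mΩ : MeasurableSpace Ω}

/-- The set of all stopping times of the filtration, with values in `[0, ∞]`. -/
abbrev StopTime (𝓕 : Filtration ℝ≥0 mΩ) : Type _ :=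
  {τ : Ω → WithTop ℝ≥0 // IsStoppingTime 𝓕 τ}

/-- `π` is an admissible (discounted) revenue process: product-measurable, `P ⊗ dt`-integrable, and
the revenues accrued up to time `t` are `𝓕 t`-measurable for each `t`. -/
structure IsRevenueProcess (P : Measure Ω) (𝓕 : Filtration ℝ≥0 mΩ) (π : ℝ≥0 → Ω → ℝ) : Prop where
  measurable : Measurable (fun p : Ω × ℝ≥0 => π p.2 p.1)
  integrable : Integrable (fun p : Ω × ℝ≥0 => π p.2 p.1) (P.prod timeMeasure)
  adapted : ∀ t : ℝ≥0, Measurable[𝓕 t] (fun ω => ∫ s in Set.Iic t, π s ω ∂timeMeasure)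

/-- The revenue `∫_a^b π_s ds` accrued between the random dates `a ≤ b` in `[0, ∞]`. -/
noncomputable def accrued (π : ℝ≥0 → Ω → ℝ) (a b : Ω → WithTop ℝ≥0) (ω : Ω) : ℝ :=
  ∫ s in {s : ℝ≥0 | a ω < (s : WithTop ℝ≥0) ∧ (s : WithTop ℝ≥0) ≤ b ω}, π s ω ∂timeMeasure

/-- `X` is (a version of) the essential supremum under `P` of the family `S` of real random
variables. -/
structure IsEssSup (P : Measure Ω) (S : Set (Ω → ℝ)) (X : Ω → ℝ) : Prop where
  aemeasurable : AEMeasurable X P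
  le : ∀ Y ∈ S, Y ≤ᵐ[P] X
  least : ∀ Z : Ω → ℝ, AEMeasurable Z P → (∀ Y ∈ S, Y ≤ᵐ[P] Z) → X ≤ᵐ[P] Z

/-- The essential supremum exists for every nonempty family bounded above by a random variable. -/
theorem exists_isEssSup (P : Measure Ω) [IsProbabilityMeasure P] (S : Set (Ω → ℝ))
    (hne : S.Nonempty) (hmeas : ∀ Y ∈ S, AEMeasurable Y P) (g : Ω → ℝ)
    (hg : ∀ Y ∈ S, Y ≤ᵐ[P] g) : ∃ X, IsEssSup P S X := by
  obtain ⟨Y₀, hY₀⟩ := hne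
  let G : (ℕ → S) → Ω → ℝ := fun u ω => ⨆ n, (u n : Ω → ℝ) ω
  let Φ : (ℕ → S) → ℝ := fun u => ∫ ω, Real.arctan (G u ω) ∂P
  have hG : ∀ u, AEMeasurable (G u) P := fun u => AEMeasurable.iSup fun n => hmeas _ (u n).2
  have hbdd : ∀ u : ℕ → S, ∀ᵐ ω ∂P, BddAbove (Set.range fun n => (u n : Ω → ℝ) ω) := by
    intro u
    have h : ∀ᵐ ω ∂P, ∀ n, (u n : Ω → ℝ) ω ≤ g ω := ae_all_iff.2 fun n => hg _ (u n).2
    filter_upwards [h] with ω hω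
    exact ⟨g ω, by rintro _ ⟨n, rfl⟩; exact hω n⟩
  have hint : ∀ u, Integrable (fun ω => Real.arctan (G u ω)) P := by
    intro u
    refine Integrable.of_bound
      (Real.measurable_arctan.comp_aemeasurable (hG u)).aestronglyMeasurable (Real.pi / 2) ?_
    refine Filter.Eventually.of_forall fun ω => ?_
    rw [Real.norm_eq_abs, abs_le]
    exact ⟨(Real.neg_pi_div_two_lt_arctan _).le, (Real.arctan_lt_pi_div_two _).le⟩
  have hmono : ∀ u v : ℕ → S, Set.range u ⊆ Set.range v → G u ≤ᵐ[P] G v := by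
    intro u v huv
    filter_upwards [hbdd v] with ω hω
    refine ciSup_le fun n => ?_
    obtain ⟨m, hm⟩ := huv ⟨n, rfl⟩
    rw [← hm]
    exact le_ciSup hω m
  have hΦmono : ∀ u v : ℕ → S, Set.range u ⊆ Set.range v → Φ u ≤ Φ v := by
    intro u v huv
    refine integral_mono_ae (hint u) (hint v) ?_
    filter_upwards [hmono u v huv] with ω hω
    exact Real.arctan_strictMono.monotone hω
  have hΦbdd : BddAbove (Set.range Φ) := by
    refine ⟨∫ _, Real.pi / 2 ∂P, ?_⟩
    rintro _ ⟨u, rfl⟩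
    exact integral_mono (hint u) (integrable_const _) fun ω => (Real.arctan_lt_pi_div_two _).le
  have hΦne : (Set.range Φ).Nonempty := ⟨_, ⟨fun _ => ⟨Y₀, hY₀⟩, rfl⟩⟩
  obtain ⟨c, -, hc, hcmem⟩ := exists_seq_tendsto_sSup hΦne hΦbdd
  choose u hu using hcmem
  let w : ℕ → S := fun n => u n.unpair.1 n.unpair.2
  have hw : ∀ k, Set.range (u k) ⊆ Set.range w := by
    rintro k _ ⟨n, rfl⟩
    exact ⟨Nat.pair k n, by simp [w]⟩
  have hwsup : sSup (Set.range Φ) ≤ Φ w :=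
    le_of_tendsto' hc fun k => (hu k).symm.le.trans (hΦmono _ _ (hw k))
  refine ⟨G w, hG w, fun Y hY => ?_, fun Z _ hZ => ?_⟩
  · let v : ℕ → S := fun n => Nat.casesOn n ⟨Y, hY⟩ w
    have hwv : Set.range w ⊆ Set.range v := by
      rintro _ ⟨n, rfl⟩
      exact ⟨n + 1, rfl⟩
    have heq : Φ w = Φ v :=
      le_antisymm (hΦmono _ _ hwv) ((le_csSup hΦbdd ⟨v, rfl⟩).trans hwsup)
    have hle : (fun ω => Real.arctan (G w ω)) ≤ᵐ[P] fun ω => Real.arctan (G v ω) := by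
      filter_upwards [hmono w v hwv] with ω hω
      exact Real.arctan_strictMono.monotone hω
    have hae := (integral_eq_iff_of_ae_le (hint w) (hint v) hle).1 heq
    filter_upwards [hae, hbdd v] with ω hω hb
    have h1 : G w ω = G v ω := Real.arctan_injective hω
    rw [h1]
    exact le_ciSup hb 0
  · have h : ∀ᵐ ω ∂P, ∀ n, (w n : Ω → ℝ) ω ≤ Z ω := ae_all_iff.2 fun n => hZ _ (w n).2
    filter_upwards [h] with ω hω
    exact ciSup_le hω

open Classical in
/-- The essential supremum of a family of real random variables, unique up to `P`-null sets (`0` if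
there is none, i.e. if the family is empty or not bounded above by a real random variable). -/
noncomputable def familyEssSup (P : Measure Ω) (S : Set (Ω → ℝ)) : Ω → ℝ :=
  if h : ∃ X, IsEssSup P S X then h.choose else 0

end Basic

section Stopping

variable {Ω : Type*} {mΩ : MeasurableSpace Ω} (P : Measure Ω) {𝓕 : Filtration ℝ≥0 mΩ}

/-- The conditional values `E[X(τ) | 𝓕_θ]` of all stopping times `τ ≥ θ`, in the problem of stopping
optimally, from `θ` on, the payoffs `X(τ)`. -/
def conditionalValues (θ : StopTime 𝓕) (X : StopTime 𝓕 → Ω → ℝ) : Set (Ω → ℝ) :=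
  {Y | ∃ τ : StopTime 𝓕, θ.1 ≤ᵐ[P] τ.1 ∧ Y = P[X τ | θ.2.measurableSpace]}

/-- `τ ≥ θ` attains `ess sup_{τ ≥ θ} E[X(τ) | 𝓕_θ]`. -/
def Attains (θ : StopTime 𝓕) (X : StopTime 𝓕 → Ω → ℝ) (τ : StopTime 𝓕) : Prop :=
  θ.1 ≤ᵐ[P] τ.1 ∧ IsEssSup P (conditionalValues P θ X) (P[X τ | θ.2.measurableSpace])

/-- `τ` is the latest stopping time attaining `ess sup_{τ ≥ θ} E[X(τ) | 𝓕_θ]`. -/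
def IsLatestSolution (θ : StopTime 𝓕) (X : StopTime 𝓕 → Ω → ℝ) (τ : StopTime 𝓕) : Prop :=
  Attains P θ X τ ∧ ∀ σ : StopTime 𝓕, Attains P θ X σ → σ.1 ≤ᵐ[P] τ.1

/-- The revenue `∫_τ^{τ'} πF_s ds + ∫_{τ'}^∞ πB_s ds` that a follower collects from `τ` on, when the
opponent invests at `τ` and it follows at `τ'`. -/
noncomputable def followerRevenue (πF πB : ℝ≥0 → Ω → ℝ) (τ τ' : StopTime 𝓕) (ω : Ω) : ℝ :=
  accrued πF τ.1 τ'.1 ω + accrued πB τ'.1 (fun _ => ⊤) ω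

/-- The follower payoff
`F(τ) = ∫_0^τ π0_s ds + ess sup_{τ' ≥ τ} E[∫_τ^{τ'} πF_s ds + ∫_{τ'}^∞ πB_s ds | 𝓕_τ]`. -/
noncomputable def followerPayoff (π0 πF πB : ℝ≥0 → Ω → ℝ) (τ : StopTime 𝓕) (ω : Ω) : ℝ :=
  accrued π0 (fun _ => 0) τ.1 ω +
    familyEssSup P (conditionalValues P τ (followerRevenue πF πB τ)) ω

/-- `σ` is the follower's reaction time `τ_F(τ)`: the latest stopping time attaining `F(τ)`. -/
def IsFollowerReaction (πF πB : ℝ≥0 → Ω → ℝ) (τ σ : StopTime 𝓕) : Prop :=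
  IsLatestSolution P τ (followerRevenue πF πB τ) σ

/-- The simultaneous-investment payoff `M(τ) = ∫_0^τ π0_s ds + E[∫_τ^∞ πB_s ds | 𝓕_τ]`. -/
noncomputable def simultaneousPayoff (π0 πB : ℝ≥0 → Ω → ℝ) (τ : StopTime 𝓕) (ω : Ω) : ℝ :=
  accrued π0 (fun _ => 0) τ.1 ω +
    (P[accrued πB τ.1 (fun _ => ⊤) | τ.2.measurableSpace]) ω

/-- The realized revenue `∫_0^τ π0_s ds + ∫_τ^∞ πB_s ds` under simultaneous investment at `τ`. -/
noncomputable def simultaneousRevenue (π0 πB : ℝ≥0 → Ω → ℝ) (τ : StopTime 𝓕) (ω : Ω) : ℝ :=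
  accrued π0 (fun _ => 0) τ.1 ω + accrued πB τ.1 (fun _ => ⊤) ω

end Stopping

end InvestmentTiming

namespace InvestmentTiming

open Filter Topology

/-! Two comparisons carry the theorem. A follower may react at once, so `M(τ) ≤ F(τ)`. Conversely,
let `σ` be an optimal reaction to `τ`. Since `π0 ≥ πF`, replacing `πF` by `π0` between `τ` and `σ`
can only raise the revenue and turns it into that of simultaneous investment at `σ`, so `E[F(τ) |
𝓕_θ] ≤ E[M(σ) | 𝓕_θ]`. Hence (S) and (F) have the same value: a maximizer of (S) is one of (F), and
the reaction to a maximizer of (F) solves (S). As reactions never come earlier than the investment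
they answer, the latest solution of (S) also dominates every solution of (F). These steps are
`simultaneousPayoff_ae_le_followerPayoff` and `condExp_followerPayoff_le`.

What remains is the existence of latest solutions, for (S) and for the reaction problem. Up to a
term independent of the stopping time, both maximize the revenue accrued up to that time from a
difference process (`π0 - πB` or `πF - πB`). Pasting along events known at `θ` reduces the
conditional problem to an unconditional one (`attains_iff_maximizes`). The functional `J(τ) =
E[∫_0^τ π]` is bounded, modular on the lattice of stopping times and continuous under pointwise
limits, and such a functional has a latest maximizer (`exists_latest_maximizes`). -/

instance instNullSingletonClassTimeMeasure : NullSingletonClass timeMeasure where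
  measure_singleton t := by
    rw [timeMeasure, measurableEmbedding_coe_nnreal.comap_apply, Set.image_singleton,
      Real.volume_singleton]

/-! ### Accrued revenue along a single path -/

section Path

theorem measurableSet_window (a b : WithTop ℝ≥0) :
    MeasurableSet {s : ℝ≥0 | a < (s : WithTop ℝ≥0) ∧ (s : WithTop ℝ≥0) ≤ b} :=
  (measurableSet_lt measurable_const WithTop.measurable_coe).inter
    (measurableSet_le WithTop.measurable_coe measurable_const)

/-- Dominated convergence: as the endpoint tends to `b`, the indicator of the window is eventually
constant at every date `s ≠ b`, and a single date is null. Continuity includes `b = ⊤`. -/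
theorem continuous_setIntegral_window {f : ℝ≥0 → ℝ} (hf : Integrable f timeMeasure)
    (a : WithTop ℝ≥0) :
    Continuous fun b : WithTop ℝ≥0 =>
      ∫ s in {s : ℝ≥0 | a < (s : WithTop ℝ≥0) ∧ (s : WithTop ℝ≥0) ≤ b}, f s ∂timeMeasure := by
  simp_rw [← integral_indicator (measurableSet_window _ _)]
  refine continuous_iff_continuousAt.2 fun b => ?_
  refine continuousAt_of_dominated (bound := fun s => ‖f s‖)
    (Eventually.of_forall fun c => (hf.indicator (measurableSet_window a c)).aestronglyMeasurable)
    (Eventually.of_forall fun c => Eventually.of_forall fun s => norm_indicator_le_norm_self _ _)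
    hf.norm ?_
  have hb : ∀ᵐ s : ℝ≥0 ∂timeMeasure, (s : WithTop ℝ≥0) ≠ b := by
    induction b with
    | top => exact Eventually.of_forall fun s => WithTop.coe_ne_top
    | coe b =>
      filter_upwards [(measure_eq_zero_iff_ae_notMem.1 (measure_singleton (μ := timeMeasure) b))]
        with s hs h
      exact hs (WithTop.coe_injective h)
  filter_upwards [hb] with s hs
  refine ContinuousAt.congr (f := fun _ => Set.indicator
    {s : ℝ≥0 | a < (s : WithTop ℝ≥0) ∧ (s : WithTop ℝ≥0) ≤ b} f s) continuousAt_const ?_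
  have hc : ∀ᶠ c in 𝓝 b, ((s : WithTop ℝ≥0) ≤ b ↔ (s : WithTop ℝ≥0) ≤ c) := by
    rcases hs.lt_or_gt with h | h
    · filter_upwards [lt_mem_nhds h] with c hc
      exact iff_of_true h.le hc.le
    · filter_upwards [gt_mem_nhds h] with c hc
      exact iff_of_false h.not_ge hc.not_ge
  filter_upwards [hc] with c hc
  simp only [Set.indicator_apply, Set.mem_ofPred_eq, hc]

variable {Ω : Type*} {π : ℝ≥0 → Ω → ℝ} {a b c : Ω → WithTop ℝ≥0} {ω : Ω}

theorem accrued_add_accrued (hπ : Integrable (fun s => π s ω) timeMeasure)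
    (hab : a ω ≤ b ω) (hbc : b ω ≤ c ω) :
    accrued π a b ω + accrued π b c ω = accrued π a c ω := by
  rw [accrued, accrued, accrued, ← setIntegral_union _ (measurableSet_window _ _)
    hπ.integrableOn hπ.integrableOn]
  · congr 2
    ext s
    simp only [Set.mem_union, Set.mem_ofPred_eq]
    constructor
    · rintro (⟨h1, h2⟩ | ⟨h1, h2⟩)
      · exact ⟨h1, h2.trans hbc⟩
      · exact ⟨hab.trans_lt h1, h2⟩
    · rintro ⟨h1, h2⟩
      rcases le_or_gt (s : WithTop ℝ≥0) (b ω) with h | h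
      · exact Or.inl ⟨h1, h⟩
      · exact Or.inr ⟨h, h2⟩
  · exact Set.disjoint_left.2 fun s h1 h2 => (h1.2.trans_lt h2.1).false

theorem accrued_self (π : ℝ≥0 → Ω → ℝ) (a : Ω → WithTop ℝ≥0) (ω : Ω) : accrued π a a ω = 0 := by
  have : {s : ℝ≥0 | a ω < (s : WithTop ℝ≥0) ∧ (s : WithTop ℝ≥0) ≤ a ω} = ∅ := by
    ext s
    simp only [Set.mem_ofPred_eq, Set.mem_empty_iff_false, iff_false, not_and, not_le, imp_self]
  rw [accrued, this, setIntegral_empty]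

theorem accrued_sub {π π' : ℝ≥0 → Ω → ℝ} (hπ : Integrable (fun s => π s ω) timeMeasure)
    (hπ' : Integrable (fun s => π' s ω) timeMeasure) :
    accrued (π - π') a b ω = accrued π a b ω - accrued π' a b ω :=
  integral_sub hπ.integrableOn hπ'.integrableOn

theorem accrued_mono {π π' : ℝ≥0 → Ω → ℝ} (hπ : Integrable (fun s => π s ω) timeMeasure)
    (hπ' : Integrable (fun s => π' s ω) timeMeasure) (h : ∀ᵐ s ∂timeMeasure, π s ω ≤ π' s ω) :
    accrued π a b ω ≤ accrued π' a b ω :=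
  setIntegral_mono_ae hπ.integrableOn hπ'.integrableOn h

theorem accrued_congr {a' b' : Ω → WithTop ℝ≥0} (ha : a ω = a' ω) (hb : b ω = b' ω) :
    accrued π a b ω = accrued π a' b' ω := by
  rw [accrued, accrued, ha, hb]

end Path

/-! ### Integrability and continuity of expected accrued revenue -/

section Integrability

variable {Ω : Type*} {mΩ : MeasurableSpace Ω} {P : Measure Ω}
  {π : ℝ≥0 → Ω → ℝ}

theorem ae_integrable_path [SFinite P]
    (hπ : Integrable (fun p : Ω × ℝ≥0 => π p.2 p.1) (P.prod timeMeasure)) :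
    ∀ᵐ ω ∂P, Integrable (fun s => π s ω) timeMeasure :=
  hπ.prod_right_ae

theorem integrable_accrued
    (hπ : Integrable (fun p : Ω × ℝ≥0 => π p.2 p.1) (P.prod timeMeasure))
    {a b : Ω → WithTop ℝ≥0} (ha : Measurable a) (hb : Measurable b) :
    Integrable (accrued π a b) P := by
  have hW : MeasurableSet {p : Ω × ℝ≥0 | a p.1 < (p.2 : WithTop ℝ≥0) ∧
      (p.2 : WithTop ℝ≥0) ≤ b p.1} :=
    (measurableSet_lt (ha.comp measurable_fst) (WithTop.measurable_coe.comp measurable_snd)).inter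
      (measurableSet_le (WithTop.measurable_coe.comp measurable_snd) (hb.comp measurable_fst))
  refine (hπ.indicator hW).integral_prod_left.congr (Eventually.of_forall fun ω => ?_)
  rw [accrued, ← integral_indicator (measurableSet_window _ _)]
  rfl

theorem abs_accrued_le {ω : Ω} (hπ : Integrable (fun s => π s ω) timeMeasure)
    (a b : Ω → WithTop ℝ≥0) : |accrued π a b ω| ≤ ∫ s, |π s ω| ∂timeMeasure :=
  (abs_integral_le_integral_abs).trans
    (setIntegral_le_integral hπ.abs (Eventually.of_forall fun _ => abs_nonneg _))

theorem tendsto_integral_accrued [SFinite P]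
    (hπ : Integrable (fun p : Ω × ℝ≥0 => π p.2 p.1) (P.prod timeMeasure))
    {a : Ω → WithTop ℝ≥0} (ha : Measurable a) {b : ℕ → Ω → WithTop ℝ≥0} {b' : Ω → WithTop ℝ≥0}
    (hb : ∀ n, Measurable (b n)) (hlim : ∀ ω, Tendsto (fun n => b n ω) atTop (𝓝 (b' ω))) :
    Tendsto (fun n => ∫ ω, accrued π a (b n) ω ∂P) atTop (𝓝 (∫ ω, accrued π a b' ω ∂P)) := by
  refine tendsto_integral_of_dominated_convergence (fun ω => ∫ s, |π s ω| ∂timeMeasure)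
    (fun n => (integrable_accrued hπ ha (hb n)).aestronglyMeasurable)
    hπ.abs.integral_prod_left (fun n => ?_) ?_
  · filter_upwards [ae_integrable_path hπ] with ω hω
    exact abs_accrued_le hω a (b n)
  · filter_upwards [ae_integrable_path hπ] with ω hω
    exact ((continuous_setIntegral_window hω (a ω)).tendsto (b' ω)).comp (hlim ω)

end Integrability

/-! ### Stopping times as a lattice closed under countable suprema and infima -/

section Lattice

variable {Ω : Type*} {mΩ : MeasurableSpace Ω} {𝓕 : Filtration ℝ≥0 mΩ}

noncomputable instance instLatticeStopTime : Lattice (StopTime 𝓕) :=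
  Subtype.lattice (P := fun τ => IsStoppingTime 𝓕 τ) (fun _ _ h h' => h.max h')
    (fun _ _ h h' => h.min h')

/-- The pointwise supremum of a sequence of stopping times. -/
noncomputable def iSupStop (τ : ℕ → StopTime 𝓕) : StopTime 𝓕 :=
  ⟨fun ω => ⨆ n, (τ n).1 ω, fun t => by
    simp only [iSup_le_iff, Set.ofPred_forall]
    exact MeasurableSet.iInter fun n => (τ n).2 t⟩

/-- The pointwise infimum of a sequence of stopping times. -/
noncomputable def iInfStop [𝓕.IsRightContinuous] (τ : ℕ → StopTime 𝓕) : StopTime 𝓕 :=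
  ⟨fun ω => ⨅ n, (τ n).1 ω, IsStoppingTime.iInf fun n => (τ n).2⟩

theorem tendsto_iSupStop {τ : ℕ → StopTime 𝓕} (hτ : Monotone τ) (ω : Ω) :
    Tendsto (fun n => (τ n).1 ω) atTop (𝓝 ((iSupStop τ).1 ω)) :=
  tendsto_atTop_iSup fun _ _ h => hτ h ω

theorem tendsto_iInfStop [𝓕.IsRightContinuous] {τ : ℕ → StopTime 𝓕} (hτ : Antitone τ) (ω : Ω) :
    Tendsto (fun n => (τ n).1 ω) atTop (𝓝 ((iInfStop τ).1 ω)) :=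
  tendsto_atTop_iInf fun _ _ h => hτ h ω

theorem le_iSupStop (τ : ℕ → StopTime 𝓕) (n : ℕ) : τ n ≤ iSupStop τ :=
  fun ω => le_iSup (fun n => (τ n).1 ω) n

variable {P : Measure Ω} {θ : StopTime 𝓕}

theorem ae_le_iInfStop [𝓕.IsRightContinuous] {τ : ℕ → StopTime 𝓕}
    (hτ : ∀ n, θ.1 ≤ᵐ[P] (τ n).1) : θ.1 ≤ᵐ[P] (iInfStop τ).1 := by
  filter_upwards [ae_all_iff.2 hτ] with ω hω
  exact le_iInf hω

/-- A strictly increasing bounded transformation of the time axis `[0, ∞]`. -/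
noncomputable def boundedTime : WithTop ℝ≥0 → ℝ :=
  WithTop.recTopCoe 1 fun t => 1 - (1 + (t : ℝ))⁻¹

theorem boundedTime_strictMono : StrictMono boundedTime := by
  intro x y h
  induction x with
  | top => exact absurd h not_top_lt
  | coe x =>
    have hx : (0 : ℝ) < 1 + x := by positivity
    induction y with
    | top =>
      change 1 - (1 + (x : ℝ))⁻¹ < 1
      have : 0 < (1 + (x : ℝ))⁻¹ := by positivity
      linarith
    | coe y =>
      change 1 - (1 + (x : ℝ))⁻¹ < 1 - (1 + (y : ℝ))⁻¹
      have hxy : (x : ℝ) < y := by exact_mod_cast h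
      have : (1 + (y : ℝ))⁻¹ < (1 + (x : ℝ))⁻¹ := inv_strictAnti₀ hx (by linarith)
      linarith

theorem abs_boundedTime_le (x : WithTop ℝ≥0) : |boundedTime x| ≤ 1 := by
  rw [abs_le]
  have h0 : boundedTime 0 = 0 := by
    change 1 - (1 + ((0 : ℝ≥0) : ℝ))⁻¹ = 0
    simp
  have h1 : boundedTime ⊤ = 1 := rfl
  have := boundedTime_strictMono.monotone (zero_le (a := x))
  have := boundedTime_strictMono.monotone (le_top : x ≤ ⊤)
  constructor <;> linarith

theorem integrable_boundedTime [IsProbabilityMeasure P] (τ : StopTime 𝓕) :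
    Integrable (fun ω => boundedTime (τ.1 ω)) P :=
  Integrable.of_bound
    (boundedTime_strictMono.monotone.measurable.comp τ.2.measurable').aestronglyMeasurable 1
    (Eventually.of_forall fun _ => abs_boundedTime_le _)

end Lattice

/-! ### Maximizing modular functionals of stopping times -/

section Maximization

variable {Ω : Type*} {mΩ : MeasurableSpace Ω} {P : Measure Ω} {𝓕 : Filtration ℝ≥0 mΩ}

/-- `τ ≥ θ` maximizes `J` among all stopping times after `θ`. -/
def Maximizes (P : Measure Ω) (θ : StopTime 𝓕) (J : StopTime 𝓕 → ℝ) (τ : StopTime 𝓕) : Prop :=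
  θ.1 ≤ᵐ[P] τ.1 ∧ ∀ σ : StopTime 𝓕, θ.1 ≤ᵐ[P] σ.1 → J σ ≤ J τ

variable {θ : StopTime 𝓕} {J : StopTime 𝓕 → ℝ}

theorem ae_le_inf {σ τ : StopTime 𝓕} (hσ : θ.1 ≤ᵐ[P] σ.1) (hτ : θ.1 ≤ᵐ[P] τ.1) :
    θ.1 ≤ᵐ[P] (σ ⊓ τ).1 := by
  filter_upwards [hσ, hτ] with ω h1 h2
  exact le_inf h1 h2

theorem ae_le_trans_le {σ τ : StopTime 𝓕} (hσ : θ.1 ≤ᵐ[P] σ.1) (hτ : σ ≤ τ) :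
    θ.1 ≤ᵐ[P] τ.1 :=
  hσ.trans (Eventually.of_forall hτ)

/-- A bounded modular functional on stopping times that is continuous under pointwise limits
attains its maximum. -/
theorem exists_maximizes [𝓕.IsRightContinuous]
    (hbdd : ∃ C, ∀ τ, J τ ≤ C) (hmod : ∀ σ τ, J (σ ⊔ τ) + J (σ ⊓ τ) = J σ + J τ)
    (hcont : ∀ (τ : ℕ → StopTime 𝓕) (τ' : StopTime 𝓕),
      (∀ ω, Tendsto (fun n => (τ n).1 ω) atTop (𝓝 (τ'.1 ω))) →
      Tendsto (fun n => J (τ n)) atTop (𝓝 (J τ'))) :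
    ∃ τ, Maximizes P θ J τ := by
  obtain ⟨C, hC⟩ := hbdd
  set V := sSup (J '' {σ | θ.1 ≤ᵐ[P] σ.1}) with hV
  have hVbdd : BddAbove (J '' {σ | θ.1 ≤ᵐ[P] σ.1}) := ⟨C, by rintro _ ⟨σ, -, rfl⟩; exact hC σ⟩
  have hle : ∀ σ : StopTime 𝓕, θ.1 ≤ᵐ[P] σ.1 → J σ ≤ V := fun σ hσ => le_csSup hVbdd ⟨σ, hσ, rfl⟩
  have hθθ : θ.1 ≤ᵐ[P] θ.1 := EventuallyLE.refl _ _
  have hex : ∀ n : ℕ, ∃ σ : StopTime 𝓕, θ.1 ≤ᵐ[P] σ.1 ∧ V - (1 / 2) ^ n < J σ := by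
    intro n
    obtain ⟨_, ⟨σ, hσ, rfl⟩, h⟩ := exists_lt_of_lt_csSup (s := J '' {σ | θ.1 ≤ᵐ[P] σ.1})
      ⟨_, θ, hθθ, rfl⟩ (b := V - (1 / 2) ^ n) (by
        rw [← hV]; have : (0 : ℝ) < (1 / 2) ^ n := by positivity
        linarith)
    exact ⟨σ, hσ, h⟩
  choose τ hτθ hτ using hex
  -- The maximizer will be the limsup of the near-maximizers `τ n`: `S m k` is the supremum of `τ m,
  -- …, τ (m + k)`, its limit in `k` is `R m`, and the infimum of the `R m` is the limsup.
  let S : ℕ → ℕ → StopTime 𝓕 := fun m k => partialSups (fun i => τ (m + i)) k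
  have hSθ : ∀ m k, θ.1 ≤ᵐ[P] (S m k).1 := fun m k =>
    ae_le_trans_le (hτθ (m + 0)) (le_partialSups_of_le (fun i => τ (m + i)) (Nat.zero_le k))
  -- The loss is the geometric sum of `(1 / 2) ^ i` over `m ≤ i ≤ m + k`: adjoining one more `τ i`
  -- to the supremum costs at most its own defect, because modularity leaves only `J` of an infimum
  -- to subtract, and this is at most `V`.
  have hS : ∀ m k, V - (2 * (1 / 2) ^ m - (1 / 2) ^ (m + k)) ≤ J (S m k) := by
    intro m k
    induction k with
    | zero =>
      have h0 : S m 0 = τ m := by simp [S]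
      rw [h0]
      have := hτ m
      simp only [add_zero]
      linarith
    | succ k ih =>
      have h0 : S m (k + 1) = S m k ⊔ τ (m + (k + 1)) := by
        simp only [S]
        rw [← Order.succ_eq_add_one, partialSups_succ, Order.succ_eq_add_one]
      rw [h0]
      have h1 := hmod (S m k) (τ (m + (k + 1)))
      have h2 := hle _ (ae_le_inf (hSθ m k) (hτθ (m + (k + 1))))
      have h3 := hτ (m + (k + 1))
      have h4 : ((1 : ℝ) / 2) ^ (m + k) = 2 * (1 / 2) ^ (m + (k + 1)) := by
        rw [← add_assoc, pow_succ]; ring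
      linarith
  let R : ℕ → StopTime 𝓕 := fun m => iSupStop (S m)
  have hRθ : ∀ m, θ.1 ≤ᵐ[P] (R m).1 := fun m => ae_le_trans_le (hSθ m 0) (le_iSupStop (S m) 0)
  have hR : ∀ m, V - 2 * (1 / 2) ^ m ≤ J (R m) := by
    intro m
    refine ge_of_tendsto' (hcont (S m) (R m) (tendsto_iSupStop (partialSups _).monotone))
      fun k => ?_
    have := hS m k
    have : (0 : ℝ) < (1 / 2) ^ (m + k) := by positivity
    linarith
  have hRanti : Antitone R := by
    refine antitone_nat_of_succ_le fun m ω => iSup_le fun k => ?_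
    have h1 : S (m + 1) k ≤ S m (k + 1) := by
      refine partialSups_le _ _ _ fun i hi => ?_
      have : m + 1 + i = m + (i + 1) := by ring
      rw [this]
      exact le_partialSups_of_le (fun i => τ (m + i)) (Nat.succ_le_succ hi)
    exact (h1 ω).trans (le_iSupStop (S m) (k + 1) ω)
  refine ⟨iInfStop R, ae_le_iInfStop hRθ, fun σ hσ => (hle σ hσ).trans ?_⟩
  refine le_of_tendsto_of_tendsto' ?_ (hcont R _ (tendsto_iInfStop hRanti)) hR
  have : Tendsto (fun m : ℕ => V - 2 * (1 / 2 : ℝ) ^ m) atTop (𝓝 (V - 2 * 0)) :=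
    ((tendsto_pow_atTop_nhds_zero_of_lt_one (by norm_num) (by norm_num)).const_mul 2).const_sub V
  simpa using this

/-- The infimum is admissible, so `J (σ ⊓ τ) ≤ J τ`, and modularity then forces `J (σ ⊔ τ) ≥ J σ`.
-/
theorem Maximizes.sup (hmod : ∀ σ τ, J (σ ⊔ τ) + J (σ ⊓ τ) = J σ + J τ) {σ τ : StopTime 𝓕}
    (hσ : Maximizes P θ J σ) (hτ : Maximizes P θ J τ) : Maximizes P θ J (σ ⊔ τ) := by
  refine ⟨ae_le_trans_le hσ.1 le_sup_left, fun ρ hρ => ?_⟩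
  have h1 := hmod σ τ
  have h2 := hτ.2 _ (ae_le_inf hσ.1 hτ.1)
  have h3 := hσ.2 ρ hρ
  linarith

/-- A bounded modular functional on stopping times that is continuous under pointwise limits
has a latest maximizer. -/
theorem exists_latest_maximizes [IsProbabilityMeasure P] [𝓕.IsRightContinuous]
    (hbdd : ∃ C, ∀ τ, J τ ≤ C) (hmod : ∀ σ τ, J (σ ⊔ τ) + J (σ ⊓ τ) = J σ + J τ)
    (hcont : ∀ (τ : ℕ → StopTime 𝓕) (τ' : StopTime 𝓕),
      (∀ ω, Tendsto (fun n => (τ n).1 ω) atTop (𝓝 (τ'.1 ω))) →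
      Tendsto (fun n => J (τ n)) atTop (𝓝 (J τ'))) :
    ∃ τ, Maximizes P θ J τ ∧ ∀ σ, Maximizes P θ J σ → σ.1 ≤ᵐ[P] τ.1 := by
  obtain ⟨τ₀, hτ₀⟩ := exists_maximizes (P := P) (θ := θ) hbdd hmod hcont
  -- `K` measures lateness by a finite number. Maximizers are closed under suprema of sequences, so
  -- `K` attains its supremum over them; strict monotonicity of `boundedTime` makes such a maximizer
  -- a.s. the latest.
  let K : StopTime 𝓕 → ℝ := fun τ => ∫ ω, boundedTime (τ.1 ω) ∂P
  have hK : BddAbove (K '' {σ | Maximizes P θ J σ}) := by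
    refine ⟨∫ _, 1 ∂P, ?_⟩
    rintro _ ⟨σ, -, rfl⟩
    exact integral_mono (integrable_boundedTime σ) (integrable_const _)
      fun ω => (abs_le.1 (abs_boundedTime_le _)).2
  have hKmono : ∀ σ τ : StopTime 𝓕, σ ≤ τ → K σ ≤ K τ := fun σ τ h =>
    integral_mono (integrable_boundedTime σ) (integrable_boundedTime τ)
      fun ω => boundedTime_strictMono.monotone (h ω)
  obtain ⟨c, -, hc, hcmem⟩ := exists_seq_tendsto_sSup (S := K '' {σ | Maximizes P θ J σ})
    ⟨_, τ₀, hτ₀, rfl⟩ hK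
  choose τ hτ hτc using hcmem
  have hpart : ∀ n, Maximizes P θ J (partialSups τ n) := by
    intro n
    induction n with
    | zero => simpa using hτ 0
    | succ n ih =>
      rw [← Order.succ_eq_add_one, partialSups_succ]
      exact ih.sup hmod (hτ _)
  set w := iSupStop (partialSups τ) with hw
  have hτw : ∀ n, τ n ≤ w := fun n => (le_partialSups τ n).trans (le_iSupStop _ n)
  have hwmax : Maximizes P θ J w :=
    ⟨ae_le_trans_le (hτ 0).1 (hτw 0), fun σ hσ =>
      ge_of_tendsto' (hcont _ w (tendsto_iSupStop (partialSups τ).monotone))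
        fun n => (hpart n).2 σ hσ⟩
  have hKw : sSup (K '' {σ | Maximizes P θ J σ}) ≤ K w :=
    le_of_tendsto' hc fun n => (hτc n).symm.le.trans (hKmono _ _ (hτw n))
  refine ⟨w, hwmax, fun σ hσ => ?_⟩
  have heq : K w = K (σ ⊔ w) :=
    le_antisymm (hKmono _ _ le_sup_right) ((le_csSup hK ⟨_, hσ.sup hmod hwmax, rfl⟩).trans hKw)
  have hae := (integral_eq_iff_of_ae_le (integrable_boundedTime w) (integrable_boundedTime (σ ⊔ w))
    (Eventually.of_forall fun ω => boundedTime_strictMono.monotone (le_sup_right (a := σ) ω))).1 heq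
  filter_upwards [hae] with ω hω
  have h1 : w.1 ω = (σ ⊔ w).1 ω := boundedTime_strictMono.injective hω
  rw [h1]
  exact le_sup_left (b := w) ω

end Maximization

/-! ### The σ-algebra at a stopping time -/

section StoppedSigmaAlgebra

variable {Ω : Type*} {mΩ : MeasurableSpace Ω} {P : Measure Ω} {𝓕 : Filtration ℝ≥0 mΩ}

/-- The part of `s ∩ {τ ≤ i}` where `σ > i` is null, hence already in `𝓕 0` by completeness. -/
theorem measurableSpace_mono_of_ae_le (hcomplete : ∀ N : Set Ω, P N = 0 → MeasurableSet[𝓕 0] N)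
    {σ τ : StopTime 𝓕} (h : σ.1 ≤ᵐ[P] τ.1) : σ.2.measurableSpace ≤ τ.2.measurableSpace := by
  refine fun s hs => ⟨hs.1, fun i => ?_⟩
  have hset : s ∩ {ω | τ.1 ω ≤ i} = s ∩ {ω | σ.1 ω ≤ i} ∩ {ω | τ.1 ω ≤ i} ∪
      s ∩ {ω | τ.1 ω ≤ i} ∩ {ω | ¬ σ.1 ω ≤ i} := by
    ext ω
    simp only [Set.mem_inter_iff, Set.mem_union, Set.mem_ofPred_eq]
    tauto
  rw [hset]
  refine ((hs.2 i).inter (τ.2 i)).union (𝓕.mono (zero_le (a := i)) _ (hcomplete _ ?_))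
  refine measure_mono_null (fun ω hω => ?_) h
  exact fun hle => hω.2 (le_trans hle hω.1.2)

/-- Two stopping times after `θ` can be pasted along an event that is known at `θ`. -/
theorem exists_paste (hcomplete : ∀ N : Set Ω, P N = 0 → MeasurableSet[𝓕 0] N)
    {θ σ τ : StopTime 𝓕} (hσ : θ.1 ≤ᵐ[P] σ.1) (hτ : θ.1 ≤ᵐ[P] τ.1) {B : Set Ω}
    (hB : MeasurableSet[θ.2.measurableSpace] B) :
    ∃ ρ : StopTime 𝓕, θ.1 ≤ᵐ[P] ρ.1 ∧ (∀ ω ∈ B, ρ.1 ω = σ.1 ω) ∧ ∀ ω ∉ B, ρ.1 ω = τ.1 ω := by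
  classical
  refine ⟨⟨B.piecewise σ.1 τ.1, fun i => ?_⟩, ?_, fun ω h => Set.piecewise_eq_of_mem _ _ _ h,
    fun ω h => Set.piecewise_eq_of_notMem _ _ _ h⟩
  · have hset : {ω | B.piecewise σ.1 τ.1 ω ≤ i} =
        B ∩ {ω | σ.1 ω ≤ i} ∪ Bᶜ ∩ {ω | τ.1 ω ≤ i} := by
      ext ω
      by_cases h : ω ∈ B <;> simp [h]
    rw [hset]
    exact (measurableSpace_mono_of_ae_le hcomplete hσ B hB).2 i |>.union
      ((measurableSpace_mono_of_ae_le hcomplete hτ Bᶜ hB.compl).2 i)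
  · filter_upwards [hσ, hτ] with ω h1 h2
    by_cases h : ω ∈ B
    · simpa [h] using h1
    · simpa [h] using h2

/-- The revenue accrued up to a stopping time is known at that time. -/
theorem aestronglyMeasurable_accrued [IsProbabilityMeasure P]
    (hcomplete : ∀ N : Set Ω, P N = 0 → MeasurableSet[𝓕 0] N)
    {π : ℝ≥0 → Ω → ℝ} (hπ : IsRevenueProcess P 𝓕 π) (τ : StopTime 𝓕) :
    AEStronglyMeasurable[τ.2.measurableSpace] (accrued π (fun _ => 0) τ.1) P := by
  classical
  set N : Set Ω := {ω | ¬ Integrable (fun s => π s ω) timeMeasure} with hN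
  have hN0 : P N = 0 := ae_integrable_path hπ.integrable
  have hNmeas : ∀ t, MeasurableSet[𝓕 t] N := fun t => 𝓕.mono (zero_le (a := t)) _ (hcomplete _ hN0)
  -- Zeroing the null set of non-integrable paths makes every path continuous while keeping
  -- adaptedness, since `N` lies in each `𝓕 t`.
  let G : WithTop ℝ≥0 → Ω → ℝ := fun b => N.piecewise 0 (accrued π (fun _ => 0) fun _ => b)
  have hGcont : ∀ ω, Continuous fun b => G b ω := by
    intro ω
    by_cases h : ω ∈ N
    · simp only [G, Set.piecewise_eq_of_mem _ _ _ h]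
      exact continuous_const
    · simp only [G, Set.piecewise_eq_of_notMem _ _ _ h]
      exact continuous_setIntegral_window (not_not.1 h) 0
  have hIic : ∀ (t : ℝ≥0) ω, accrued π (fun _ => 0) (fun _ => (t : WithTop ℝ≥0)) ω =
      ∫ s in Set.Iic t, π s ω ∂timeMeasure := by
    intro t ω
    refine setIntegral_congr_set ?_
    have h0 := measure_eq_zero_iff_ae_notMem.1 (measure_singleton (μ := timeMeasure) 0)
    filter_upwards [h0] with s hs
    have hs0 : (0 : WithTop ℝ≥0) < (s : WithTop ℝ≥0) := by
      exact_mod_cast pos_iff_ne_zero.2 hs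
    refine propext ⟨fun h => WithTop.coe_le_coe.1 h.2, fun h => ⟨hs0, WithTop.coe_le_coe.2 h⟩⟩
  let A : ℝ≥0 → Ω → ℝ := fun t => G t
  have hA : StronglyAdapted 𝓕 A := by
    intro t
    refine Measurable.stronglyMeasurable ?_
    refine Measurable.piecewise (hNmeas t) measurable_const ?_
    have : accrued π (fun _ => 0) (fun _ => (t : WithTop ℝ≥0)) =
      fun ω => ∫ s in Set.Iic t, π s ω ∂timeMeasure := funext (hIic t)
    rw [this]
    exact hπ.adapted t
  have hAcont : ∀ ω, Continuous fun t => A t ω := fun ω =>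
    (hGcont ω).comp WithTop.continuous_coe
  have hstopped := hA.stoppedProcess hAcont τ.2
  have hstoppedG : ∀ (t : ℝ≥0) ω, stoppedProcess A τ.1 t ω = G (min t (τ.1 ω)) ω := by
    intro t ω
    have hne : min (t : WithTop ℝ≥0) (τ.1 ω) ≠ ⊤ :=
      ne_top_of_le_ne_top WithTop.coe_ne_top (min_le_left _ _)
    simp only [stoppedProcess, A]
    rw [WithTop.untopA_eq_untop hne, WithTop.coe_untop]
  let f : Ω → ℝ := fun ω => G (τ.1 ω) ω
  -- The limit `n → ∞` handles the event `τ = ⊤`, which no finite date sees. It yields measurability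
  -- for `⨆ t, 𝓕 t`, one of the two requirements of the σ-algebra at `τ`.
  have hf_lim : ∀ ω, Tendsto (fun n : ℕ => stoppedProcess A τ.1 (n : ℝ≥0) ω) atTop (𝓝 (f ω)) := by
    intro ω
    simp only [hstoppedG]
    refine ((hGcont ω).tendsto (τ.1 ω)).comp ?_
    have htop : Tendsto (fun n : ℕ => (((n : ℝ≥0) : WithTop ℝ≥0))) atTop (𝓝 ⊤) := by
      refine tendsto_order.2 ⟨fun a ha => ?_, fun a ha => absurd ha not_top_lt⟩
      lift a to ℝ≥0 using ha.ne
      obtain ⟨m, hm⟩ := exists_nat_gt a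
      filter_upwards [eventually_ge_atTop m] with n hn
      exact WithTop.coe_lt_coe.2 (hm.trans_le (by exact_mod_cast hn))
    simpa using htop.min (tendsto_const_nhds (x := τ.1 ω))
  have hf_top : Measurable[⨆ t, 𝓕 t] f :=
    @measurable_of_tendsto_metrizable _ _ (⨆ t, 𝓕 t) _ _ _ _ _ _
      (fun n : ℕ => ((hstopped n).measurable.mono (le_iSup 𝓕 (n : ℝ≥0)) le_rfl))
      (tendsto_pi_nhds.2 hf_lim)
  have hf : Measurable[τ.2.measurableSpace] f := by
    refine fun s hs => ⟨hf_top hs, fun i => ?_⟩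
    -- Once `τ ≤ i`, the process stopped at `τ` has already reached its final value at date `i`.
    have hset : f ⁻¹' s ∩ {ω | τ.1 ω ≤ i} = stoppedProcess A τ.1 i ⁻¹' s ∩ {ω | τ.1 ω ≤ i} := by
      ext ω
      simp only [Set.mem_inter_iff, Set.mem_preimage, Set.mem_ofPred_eq, and_congr_left_iff]
      intro h
      rw [hstoppedG, min_eq_right h]
    rw [hset]
    exact ((hstopped i).measurable hs).inter (τ.2 i)
  refine ⟨f, hf.stronglyMeasurable, ?_⟩
  filter_upwards [measure_eq_zero_iff_ae_notMem.1 hN0] with ω hω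
  simp only [f, G, Set.piecewise_eq_of_notMem _ _ _ hω]
  exact accrued_congr rfl rfl

end StoppedSigmaAlgebra

/-! ### Essential suprema and attainment -/

section EssSup

variable {Ω : Type*} {mΩ : MeasurableSpace Ω} {P : Measure Ω} {𝓕 : Filtration ℝ≥0 mΩ}

theorem IsEssSup.ae_eq {S : Set (Ω → ℝ)} {X Y : Ω → ℝ} (hX : IsEssSup P S X)
    (hY : IsEssSup P S Y) : X =ᵐ[P] Y :=
  (hX.least Y hY.aemeasurable hY.le).antisymm (hY.least X hX.aemeasurable hX.le)

theorem IsEssSup.familyEssSup_ae_eq {S : Set (Ω → ℝ)} {X : Ω → ℝ} (hX : IsEssSup P S X) :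
    familyEssSup P S =ᵐ[P] X := by
  have h : ∃ X, IsEssSup P S X := ⟨X, hX⟩
  rw [familyEssSup, dif_pos h]
  exact h.choose_spec.ae_eq hX

/-- An upper bound belonging to the family is automatically the least one. -/
theorem attains_iff_forall_le {θ : StopTime 𝓕} {X : StopTime 𝓕 → Ω → ℝ} {τ : StopTime 𝓕} :
    Attains P θ X τ ↔ θ.1 ≤ᵐ[P] τ.1 ∧ ∀ σ : StopTime 𝓕, θ.1 ≤ᵐ[P] σ.1 →
      P[X σ | θ.2.measurableSpace] ≤ᵐ[P] P[X τ | θ.2.measurableSpace] := by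
  refine and_congr_right fun hτ => ⟨fun h σ hσ => h.le _ ⟨σ, hσ, rfl⟩, fun h => ⟨?_, ?_, ?_⟩⟩
  · exact integrable_condExp.aestronglyMeasurable.aemeasurable
  · rintro _ ⟨σ, hσ, rfl⟩
    exact h σ hσ
  · exact fun Z _ hZ => hZ _ ⟨τ, hτ, rfl⟩

end EssSup

/-! ### From conditional to unconditional stopping problems -/

section StoppingProblem

variable {Ω : Type*} {mΩ : MeasurableSpace Ω} {P : Measure Ω} {𝓕 : Filtration ℝ≥0 mΩ}
  {θ : StopTime 𝓕} {π : ℝ≥0 → Ω → ℝ}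

theorem integrable_accrued_stopTime
    (hπ : Integrable (fun p : Ω × ℝ≥0 => π p.2 p.1) (P.prod timeMeasure)) (τ : StopTime 𝓕) :
    Integrable (accrued π (fun _ => 0) τ.1) P :=
  integrable_accrued hπ measurable_const τ.2.measurable'

variable [IsProbabilityMeasure P]

/-- The expected revenue accrued up to a stopping time has a latest maximizer. -/
theorem exists_latest_maximizes_accrued [𝓕.IsRightContinuous]
    (hπ : Integrable (fun p : Ω × ℝ≥0 => π p.2 p.1) (P.prod timeMeasure)) (θ : StopTime 𝓕) :
    ∃ τ, Maximizes P θ (fun τ => ∫ ω, accrued π (fun _ => 0) τ.1 ω ∂P) τ ∧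
      ∀ σ, Maximizes P θ (fun τ => ∫ ω, accrued π (fun _ => 0) τ.1 ω ∂P) σ → σ.1 ≤ᵐ[P] τ.1 := by
  refine exists_latest_maximizes ⟨∫ ω, ∫ s, |π s ω| ∂timeMeasure ∂P, fun τ => ?_⟩
    (fun σ τ => ?_) fun τ τ' h => ?_
  · refine integral_mono_ae (integrable_accrued_stopTime hπ τ) hπ.abs.integral_prod_left ?_
    filter_upwards [ae_integrable_path hπ] with ω hω
    exact (le_abs_self _).trans (abs_accrued_le hω _ _)
  · rw [← integral_add (integrable_accrued_stopTime hπ _) (integrable_accrued_stopTime hπ _),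
      ← integral_add (integrable_accrued_stopTime hπ _) (integrable_accrued_stopTime hπ _)]
    refine integral_congr_ae (Eventually.of_forall fun ω => ?_)
    -- Modularity holds path by path: the maximum and minimum of two dates are the same two dates.
    rcases le_total (σ.1 ω) (τ.1 ω) with h | h
    · have h1 : (σ ⊔ τ).1 ω = τ.1 ω := sup_eq_right.2 h
      have h2 : (σ ⊓ τ).1 ω = σ.1 ω := inf_eq_left.2 h
      simp only [accrued, h1, h2, add_comm]
    · have h1 : (σ ⊔ τ).1 ω = σ.1 ω := sup_eq_left.2 h
      have h2 : (σ ⊓ τ).1 ω = τ.1 ω := inf_eq_right.2 h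
      simp only [accrued, h1, h2]
  · exact tendsto_integral_accrued hπ measurable_const (fun n => (τ n).2.measurable') h

/-- If the payoffs differ from the revenue accrued up to the stopping time only by a random
variable that does not depend on that stopping time, then maximizing them conditionally amounts to
maximizing the expected accrued revenue. -/
theorem attains_iff_maximizes (hcomplete : ∀ N : Set Ω, P N = 0 → MeasurableSet[𝓕 0] N)
    (hπ : Integrable (fun p : Ω × ℝ≥0 => π p.2 p.1) (P.prod timeMeasure))
    {X : StopTime 𝓕 → Ω → ℝ} {R : Ω → ℝ} (hR : Integrable R P)
    (hX : ∀ τ : StopTime 𝓕, θ.1 ≤ᵐ[P] τ.1 → P[X τ | θ.2.measurableSpace] =ᵐ[P]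
      P[fun ω => accrued π (fun _ => 0) τ.1 ω + R ω | θ.2.measurableSpace])
    (τ : StopTime 𝓕) :
    Attains P θ X τ ↔ Maximizes P θ (fun τ => ∫ ω, accrued π (fun _ => 0) τ.1 ω ∂P) τ := by
  have hle := θ.2.measurableSpace_le
  have hint : ∀ σ : StopTime 𝓕, Integrable (accrued π (fun _ => 0) σ.1) P :=
    integrable_accrued_stopTime hπ
  have hintR : ∀ σ : StopTime 𝓕, Integrable (fun ω => accrued π (fun _ => 0) σ.1 ω + R ω) P :=
    fun σ => (hint σ).add hR
  have hset : ∀ σ : StopTime 𝓕, θ.1 ≤ᵐ[P] σ.1 → ∀ B : Set Ω,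
      MeasurableSet[θ.2.measurableSpace] B → ∫ ω in B, (P[X σ | θ.2.measurableSpace]) ω ∂P =
        ∫ ω in B, accrued π (fun _ => 0) σ.1 ω ∂P + ∫ ω in B, R ω ∂P := by
    intro σ hσ B hB
    rw [integral_congr_ae (ae_restrict_of_ae (hX σ hσ)), setIntegral_condExp hle (hintR σ) hB,
      integral_add (hint σ).integrableOn hR.integrableOn]
  rw [attains_iff_forall_le]
  refine and_congr_right fun hτ => ⟨fun h σ hσ => ?_, fun h σ hσ => ?_⟩
  · have h1 := integral_mono_ae integrable_condExp integrable_condExp (h σ hσ)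
    have h2 := hset σ hσ Set.univ MeasurableSet.univ
    have h3 := hset τ hτ Set.univ MeasurableSet.univ
    simp only [setIntegral_univ] at h2 h3
    change ∫ ω, accrued π (fun _ => 0) σ.1 ω ∂P ≤ ∫ ω, accrued π (fun _ => 0) τ.1 ω ∂P
    linarith
  -- `B` is known at `θ`, so one may switch from `τ` to `σ` exactly on `B`. Optimality of `τ` in
  -- expectation bounds the gain by zero, yet the integrand is strictly positive on `B`; hence `B`
  -- is null.
  · set B : Set Ω := {ω | (P[X τ | θ.2.measurableSpace]) ω < (P[X σ | θ.2.measurableSpace]) ω}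
      with hBdef
    have hB : MeasurableSet[θ.2.measurableSpace] B :=
      stronglyMeasurable_condExp.measurableSet_lt stronglyMeasurable_condExp
    obtain ⟨ρ, hρ, hρB, hρB'⟩ := exists_paste hcomplete hσ hτ hB
    have h1 := h ρ hρ
    simp only at h1
    rw [← integral_add_compl (hle _ hB) (hint ρ), ← integral_add_compl (hle _ hB) (hint τ),
      setIntegral_congr_fun (hle _ hB) (g := accrued π (fun _ => 0) σ.1)
        (fun ω hω => accrued_congr rfl (hρB ω hω)),
      setIntegral_congr_fun (hle _ hB).compl (g := accrued π (fun _ => 0) τ.1)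
        (fun ω hω => accrued_congr rfl (hρB' ω hω))] at h1
    have h2 := hset σ hσ B hB
    have h3 := hset τ hτ B hB
    have hD : Integrable (B.indicator fun ω => (P[X σ | θ.2.measurableSpace]) ω -
        (P[X τ | θ.2.measurableSpace]) ω) P :=
      (integrable_condExp.sub integrable_condExp).indicator (hle _ hB)
    have hD0 : 0 ≤ B.indicator fun ω => (P[X σ | θ.2.measurableSpace]) ω -
        (P[X τ | θ.2.measurableSpace]) ω := by
      refine fun ω => Set.indicator_nonneg (fun ω hω => ?_) ω
      exact sub_nonneg.2 (le_of_lt hω)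
    have hDint : ∫ ω, B.indicator (fun ω => (P[X σ | θ.2.measurableSpace]) ω -
        (P[X τ | θ.2.measurableSpace]) ω) ω ∂P = 0 := by
      refine le_antisymm ?_ (integral_nonneg hD0)
      rw [integral_indicator (hle _ hB),
        integral_sub integrable_condExp.integrableOn integrable_condExp.integrableOn]
      linarith
    filter_upwards [(integral_eq_zero_iff_of_nonneg hD0 hD).1 hDint] with ω hω
    by_contra hlt
    have hωB : ω ∈ B := not_le.1 hlt
    rw [Set.indicator_of_mem hωB] at hω
    have : (P[X τ | θ.2.measurableSpace]) ω < (P[X σ | θ.2.measurableSpace]) ω := hωB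
    simp only [Pi.zero_apply] at hω
    linarith

theorem exists_isLatestSolution [𝓕.IsRightContinuous]
    (hcomplete : ∀ N : Set Ω, P N = 0 → MeasurableSet[𝓕 0] N)
    (hπ : Integrable (fun p : Ω × ℝ≥0 => π p.2 p.1) (P.prod timeMeasure))
    {X : StopTime 𝓕 → Ω → ℝ} {R : Ω → ℝ} (hR : Integrable R P)
    (hX : ∀ τ : StopTime 𝓕, θ.1 ≤ᵐ[P] τ.1 → P[X τ | θ.2.measurableSpace] =ᵐ[P]
      P[fun ω => accrued π (fun _ => 0) τ.1 ω + R ω | θ.2.measurableSpace]) :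
    ∃ τ, IsLatestSolution P θ X τ := by
  simp only [IsLatestSolution, attains_iff_maximizes hcomplete hπ hR hX]
  exact exists_latest_maximizes_accrued hπ θ

/-- An arbitrary functional `X` need not respect a.s. equality of stopping times; the
accrued-revenue representation does. This transfers attainment between two a.s. equal latest
solutions. -/
theorem Attains.congr_ae (hcomplete : ∀ N : Set Ω, P N = 0 → MeasurableSet[𝓕 0] N)
    (hπ : Integrable (fun p : Ω × ℝ≥0 => π p.2 p.1) (P.prod timeMeasure))
    {X : StopTime 𝓕 → Ω → ℝ} {R : Ω → ℝ} (hR : Integrable R P)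
    (hX : ∀ τ : StopTime 𝓕, θ.1 ≤ᵐ[P] τ.1 → P[X τ | θ.2.measurableSpace] =ᵐ[P]
      P[fun ω => accrued π (fun _ => 0) τ.1 ω + R ω | θ.2.measurableSpace])
    {σ τ : StopTime 𝓕} (hσ : Attains P θ X σ) (h : σ.1 =ᵐ[P] τ.1) : Attains P θ X τ := by
  rw [attains_iff_maximizes hcomplete hπ hR hX] at hσ ⊢
  refine ⟨hσ.1.trans h.le, fun ρ hρ => (hσ.2 ρ hρ).trans (le_of_eq (integral_congr_ae ?_))⟩
  filter_upwards [h] with ω hω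
  exact accrued_congr rfl hω

end StoppingProblem

/-! ### Simultaneous investment against following -/

section Investment

variable {Ω : Type*} {mΩ : MeasurableSpace Ω} {P : Measure Ω} {𝓕 : Filtration ℝ≥0 mΩ}
  {π0 πF πB : ℝ≥0 → Ω → ℝ} {θ : StopTime 𝓕}

theorem IsRevenueProcess.integrable_accrued {π : ℝ≥0 → Ω → ℝ} (hπ : IsRevenueProcess P 𝓕 π)
    {a b : Ω → WithTop ℝ≥0} (ha : Measurable a) (hb : Measurable b) :
    Integrable (accrued π a b) P :=
  InvestmentTiming.integrable_accrued hπ.integrable ha hb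

theorem integrable_sub_process {π π' : ℝ≥0 → Ω → ℝ} (hπ : IsRevenueProcess P 𝓕 π)
    (hπ' : IsRevenueProcess P 𝓕 π') :
    Integrable (fun p : Ω × ℝ≥0 => (π - π') p.2 p.1) (P.prod timeMeasure) :=
  hπ.integrable.sub hπ'.integrable

theorem integrable_followerRevenue (hF : IsRevenueProcess P 𝓕 πF) (hB : IsRevenueProcess P 𝓕 πB)
    (τ τ' : StopTime 𝓕) : Integrable (followerRevenue πF πB τ τ') P :=
  (hF.integrable_accrued τ.2.measurable' τ'.2.measurable').add
    (hB.integrable_accrued τ'.2.measurable' measurable_const)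

theorem integrable_simultaneousRevenue (h0 : IsRevenueProcess P 𝓕 π0)
    (hB : IsRevenueProcess P 𝓕 πB) (τ : StopTime 𝓕) :
    Integrable (simultaneousRevenue π0 πB τ) P :=
  (h0.integrable_accrued measurable_const τ.2.measurable').add
    (hB.integrable_accrued τ.2.measurable' measurable_const)

variable [IsProbabilityMeasure P]

theorem simultaneousRevenue_ae_eq (h0 : IsRevenueProcess P 𝓕 π0) (hB : IsRevenueProcess P 𝓕 πB)
    (τ : StopTime 𝓕) :
    simultaneousRevenue π0 πB τ =ᵐ[P] fun ω => accrued (π0 - πB) (fun _ => 0) τ.1 ω +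
      accrued πB (fun _ => 0) (fun _ => ⊤) ω := by
  filter_upwards [ae_integrable_path h0.integrable, ae_integrable_path hB.integrable] with ω h1 h2
  rw [simultaneousRevenue, accrued_sub h1 h2,
    ← accrued_add_accrued (a := fun _ => 0) (b := τ.1) (c := fun _ => ⊤) h2
      (zero_le (a := τ.1 ω)) le_top]
  ring

/-- Puts the reaction problem into the form of `attains_iff_maximizes`: the bracket depends on `τ`
but not on the reaction `τ'`. -/
theorem followerRevenue_ae_eq (hF : IsRevenueProcess P 𝓕 πF) (hB : IsRevenueProcess P 𝓕 πB)
    {τ τ' : StopTime 𝓕} (h : τ.1 ≤ᵐ[P] τ'.1) :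
    followerRevenue πF πB τ τ' =ᵐ[P] fun ω => accrued (πF - πB) (fun _ => 0) τ'.1 ω +
      (accrued πB (fun _ => 0) (fun _ => ⊤) ω - accrued πF (fun _ => 0) τ.1 ω) := by
  filter_upwards [ae_integrable_path hF.integrable, ae_integrable_path hB.integrable, h]
    with ω h1 h2 hω
  rw [followerRevenue, accrued_sub h1 h2,
    ← accrued_add_accrued (a := fun _ => 0) (b := τ'.1) (c := fun _ => ⊤) h2
      (zero_le (a := τ'.1 ω)) le_top,
    ← accrued_add_accrued (a := fun _ => 0) (c := τ'.1) h1 (zero_le (a := τ.1 ω)) hω]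
  ring

/-- The revenue accrued up to `τ` is known at `τ`, so conditioning leaves it unchanged. Both payoffs
thereby become conditional expectations at `τ`, ready for the tower property. -/
theorem accrued_add_condExp_ae_eq (hcomplete : ∀ N : Set Ω, P N = 0 → MeasurableSet[𝓕 0] N)
    (h0 : IsRevenueProcess P 𝓕 π0) (τ : StopTime 𝓕) {Y : Ω → ℝ} (hY : Integrable Y P) :
    (fun ω => accrued π0 (fun _ => 0) τ.1 ω + (P[Y | τ.2.measurableSpace]) ω) =ᵐ[P]
      P[fun ω => accrued π0 (fun _ => 0) τ.1 ω + Y ω | τ.2.measurableSpace] := by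
  have hint : Integrable (accrued π0 (fun _ => 0) τ.1) P :=
    h0.integrable_accrued measurable_const τ.2.measurable'
  filter_upwards [condExp_add hint hY τ.2.measurableSpace,
    condExp_of_aestronglyMeasurable' τ.2.measurableSpace_le
      (aestronglyMeasurable_accrued hcomplete h0 τ) hint] with ω h1 h2
  change _ = (P[accrued π0 (fun _ => 0) τ.1 + Y | τ.2.measurableSpace]) ω
  rw [h1, Pi.add_apply, h2]

theorem simultaneousPayoff_ae_eq (hcomplete : ∀ N : Set Ω, P N = 0 → MeasurableSet[𝓕 0] N)
    (h0 : IsRevenueProcess P 𝓕 π0) (hB : IsRevenueProcess P 𝓕 πB) (τ : StopTime 𝓕) :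
    simultaneousPayoff P π0 πB τ =ᵐ[P]
      P[simultaneousRevenue π0 πB τ | τ.2.measurableSpace] :=
  accrued_add_condExp_ae_eq hcomplete h0 τ (hB.integrable_accrued τ.2.measurable' measurable_const)

theorem condExp_simultaneousPayoff (hcomplete : ∀ N : Set Ω, P N = 0 → MeasurableSet[𝓕 0] N)
    (h0 : IsRevenueProcess P 𝓕 π0) (hB : IsRevenueProcess P 𝓕 πB) {τ : StopTime 𝓕}
    (hτ : θ.1 ≤ᵐ[P] τ.1) :
    P[simultaneousPayoff P π0 πB τ | θ.2.measurableSpace] =ᵐ[P]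
      P[simultaneousRevenue π0 πB τ | θ.2.measurableSpace] :=
  (condExp_congr_ae (simultaneousPayoff_ae_eq hcomplete h0 hB τ)).trans
    (condExp_condExp_of_le (measurableSpace_mono_of_ae_le hcomplete hτ) τ.2.measurableSpace_le)

/-- The follower's reaction time exists. -/
theorem exists_isFollowerReaction [𝓕.IsRightContinuous]
    (hcomplete : ∀ N : Set Ω, P N = 0 → MeasurableSet[𝓕 0] N)
    (hF : IsRevenueProcess P 𝓕 πF) (hB : IsRevenueProcess P 𝓕 πB) (τ : StopTime 𝓕) :
    ∃ σ, IsFollowerReaction P πF πB τ σ :=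
  exists_isLatestSolution hcomplete (integrable_sub_process hF hB)
    ((hB.integrable_accrued measurable_const measurable_const).sub
      (hF.integrable_accrued measurable_const τ.2.measurable'))
    fun _ hσ => condExp_congr_ae (followerRevenue_ae_eq hF hB hσ)

/-- The follower payoff is the conditional expectation of the revenue under an optimal reaction. -/
theorem followerPayoff_ae_eq (hcomplete : ∀ N : Set Ω, P N = 0 → MeasurableSet[𝓕 0] N)
    (h0 : IsRevenueProcess P 𝓕 π0) (hF : IsRevenueProcess P 𝓕 πF) (hB : IsRevenueProcess P 𝓕 πB)
    {τ σ : StopTime 𝓕} (hσ : Attains P τ (followerRevenue πF πB τ) σ) :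
    followerPayoff P π0 πF πB τ =ᵐ[P]
      P[fun ω => accrued π0 (fun _ => 0) τ.1 ω + followerRevenue πF πB τ σ ω |
        τ.2.measurableSpace] := by
  refine EventuallyEq.trans ?_
    (accrued_add_condExp_ae_eq hcomplete h0 τ (integrable_followerRevenue hF hB τ σ))
  filter_upwards [hσ.2.familyEssSup_ae_eq] with ω hω
  rw [followerPayoff, hω]

/-- Reacting immediately, `τ' = τ`, is an admissible reaction and yields `M(τ)`. -/
theorem simultaneousPayoff_ae_le_followerPayoff [𝓕.IsRightContinuous]
    (hcomplete : ∀ N : Set Ω, P N = 0 → MeasurableSet[𝓕 0] N)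
    (hF : IsRevenueProcess P 𝓕 πF) (hB : IsRevenueProcess P 𝓕 πB) (τ : StopTime 𝓕) :
    simultaneousPayoff P π0 πB τ ≤ᵐ[P] followerPayoff P π0 πF πB τ := by
  obtain ⟨σ, hσ, -⟩ := exists_isFollowerReaction hcomplete hF hB τ
  have hself : followerRevenue πF πB τ τ = accrued πB τ.1 (fun _ => ⊤) := by
    funext ω
    rw [followerRevenue, accrued_self, zero_add]
  filter_upwards [hσ.2.familyEssSup_ae_eq, hσ.2.le _ ⟨τ, EventuallyLE.refl _ _, rfl⟩] with ω h1 h2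
  rw [hself] at h2
  rw [simultaneousPayoff, followerPayoff, h1]
  exact add_le_add_right h2 _

theorem integrable_followerPayoff [𝓕.IsRightContinuous]
    (hcomplete : ∀ N : Set Ω, P N = 0 → MeasurableSet[𝓕 0] N)
    (h0 : IsRevenueProcess P 𝓕 π0) (hF : IsRevenueProcess P 𝓕 πF) (hB : IsRevenueProcess P 𝓕 πB)
    (τ : StopTime 𝓕) : Integrable (followerPayoff P π0 πF πB τ) P := by
  obtain ⟨σ, hσ, -⟩ := exists_isFollowerReaction hcomplete hF hB τ
  exact integrable_condExp.congr (followerPayoff_ae_eq hcomplete h0 hF hB hσ).symm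

theorem condExp_simultaneousPayoff_le [𝓕.IsRightContinuous]
    (hcomplete : ∀ N : Set Ω, P N = 0 → MeasurableSet[𝓕 0] N)
    (h0 : IsRevenueProcess P 𝓕 π0) (hF : IsRevenueProcess P 𝓕 πF) (hB : IsRevenueProcess P 𝓕 πB)
    (θ τ : StopTime 𝓕) :
    P[simultaneousPayoff P π0 πB τ | θ.2.measurableSpace] ≤ᵐ[P]
      P[followerPayoff P π0 πF πB τ | θ.2.measurableSpace] :=
  condExp_mono
    (integrable_condExp.congr (simultaneousPayoff_ae_eq hcomplete h0 hB τ).symm)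
    (integrable_followerPayoff hcomplete h0 hF hB τ)
    (simultaneousPayoff_ae_le_followerPayoff hcomplete hF hB τ)

/-- Following at an optimal reaction time is no better than investing simultaneously at that
time. -/
theorem condExp_followerPayoff_le (hcomplete : ∀ N : Set Ω, P N = 0 → MeasurableSet[𝓕 0] N)
    (h0 : IsRevenueProcess P 𝓕 π0) (hF : IsRevenueProcess P 𝓕 πF) (hB : IsRevenueProcess P 𝓕 πB)
    (hF0 : ∀ᵐ p ∂(P.prod timeMeasure), πF p.2 p.1 ≤ π0 p.2 p.1) {τ σ : StopTime 𝓕}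
    (hτ : θ.1 ≤ᵐ[P] τ.1) (hσ : Attains P τ (followerRevenue πF πB τ) σ) :
    P[followerPayoff P π0 πF πB τ | θ.2.measurableSpace] ≤ᵐ[P]
      P[simultaneousPayoff P π0 πB σ | θ.2.measurableSpace] := by
  have h1 := (condExp_congr_ae (m := θ.2.measurableSpace)
    (followerPayoff_ae_eq hcomplete h0 hF hB hσ)).trans
    (condExp_condExp_of_le (measurableSpace_mono_of_ae_le hcomplete hτ) τ.2.measurableSpace_le)
  refine h1.le.trans (EventuallyLE.trans (condExp_mono ?_
    (integrable_simultaneousRevenue h0 hB σ) ?_)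
    (condExp_simultaneousPayoff hcomplete h0 hB (hτ.trans hσ.1)).symm.le)
  · exact (h0.integrable_accrued measurable_const τ.2.measurable').add
      (integrable_followerRevenue hF hB τ σ)
  -- The two revenues differ only between `τ` and `σ`, where one earns `πF` and the other `π0`; this
  -- is where `πF ≤ π0` enters.
  · filter_upwards [ae_integrable_path h0.integrable, ae_integrable_path hF.integrable, hσ.1,
      Measure.ae_ae_of_ae_prod hF0] with ω hω0 hωF hω hle
    rw [followerRevenue, simultaneousRevenue, ← add_assoc,
      ← accrued_add_accrued (a := fun _ => 0) (c := σ.1) hω0 (zero_le (a := τ.1 ω)) hω]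
    gcongr
    exact accrued_mono hωF hω0 hle

/-- For any competitor `σ` with reaction `ρ`, conditionally on `𝓕_θ`: `F(σ) ≤ M(ρ) ≤ M(τ) ≤ F(τ)`.
-/
theorem Attains.followerPayoff_of_simultaneousPayoff [𝓕.IsRightContinuous]
    (hcomplete : ∀ N : Set Ω, P N = 0 → MeasurableSet[𝓕 0] N)
    (h0 : IsRevenueProcess P 𝓕 π0) (hF : IsRevenueProcess P 𝓕 πF) (hB : IsRevenueProcess P 𝓕 πB)
    (hF0 : ∀ᵐ p ∂(P.prod timeMeasure), πF p.2 p.1 ≤ π0 p.2 p.1) {τ : StopTime 𝓕}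
    (hτ : Attains P θ (simultaneousPayoff P π0 πB) τ) :
    Attains P θ (followerPayoff P π0 πF πB) τ := by
  rw [attains_iff_forall_le] at hτ ⊢
  refine ⟨hτ.1, fun σ hσ => ?_⟩
  obtain ⟨ρ, hρ, -⟩ := exists_isFollowerReaction hcomplete hF hB σ
  exact (condExp_followerPayoff_le hcomplete h0 hF hB hF0 hσ hρ).trans
    ((hτ.2 ρ (hσ.trans hρ.1)).trans (condExp_simultaneousPayoff_le hcomplete h0 hF hB θ τ))

/-- For any competitor `ρ`, conditionally on `𝓕_θ`: `M(ρ) ≤ F(ρ) ≤ F(τ) ≤ M(σ)`. Only optimality of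
the reaction `σ` matters, not that it is the latest. -/
theorem Attains.simultaneousPayoff_of_followerPayoff [𝓕.IsRightContinuous]
    (hcomplete : ∀ N : Set Ω, P N = 0 → MeasurableSet[𝓕 0] N)
    (h0 : IsRevenueProcess P 𝓕 π0) (hF : IsRevenueProcess P 𝓕 πF) (hB : IsRevenueProcess P 𝓕 πB)
    (hF0 : ∀ᵐ p ∂(P.prod timeMeasure), πF p.2 p.1 ≤ π0 p.2 p.1) {τ σ : StopTime 𝓕}
    (hτ : Attains P θ (followerPayoff P π0 πF πB) τ)
    (hσ : Attains P τ (followerRevenue πF πB τ) σ) :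
    Attains P θ (simultaneousPayoff P π0 πB) σ := by
  rw [attains_iff_forall_le] at hτ ⊢
  exact ⟨hτ.1.trans hσ.1, fun ρ hρ => (condExp_simultaneousPayoff_le hcomplete h0 hF hB θ ρ).trans
    ((hτ.2 ρ hρ).trans (condExp_followerPayoff_le hcomplete h0 hF hB hF0 hτ.1 hσ))⟩

end Investment

end InvestmentTiming

/-! ### The main theorem -/

theorem lemma7 {Ω : Type*} {mΩ : MeasurableSpace Ω} (P : Measure Ω) [IsProbabilityMeasure P]
    (𝓕 : Filtration ℝ≥0 mΩ) [𝓕.IsRightContinuous]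
    (hcomplete : ∀ N : Set Ω, P N = 0 → MeasurableSet[𝓕 0] N)
    (π0 πF πB : ℝ≥0 → Ω → ℝ)
    (h0 : InvestmentTiming.IsRevenueProcess P 𝓕 π0)
    (hF : InvestmentTiming.IsRevenueProcess P 𝓕 πF)
    (hB : InvestmentTiming.IsRevenueProcess P 𝓕 πB)
    (hF0 : ∀ᵐ p ∂(P.prod InvestmentTiming.timeMeasure), πF p.2 p.1 ≤ π0 p.2 p.1)
    (θ : InvestmentTiming.StopTime 𝓕) :
    -- the two forms of the simultaneous-investment problem have the same value
    InvestmentTiming.familyEssSup P (InvestmentTiming.conditionalValues P θ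
        (InvestmentTiming.simultaneousPayoff P π0 πB)) =ᵐ[P]
      InvestmentTiming.familyEssSup P (InvestmentTiming.conditionalValues P θ
        (InvestmentTiming.simultaneousRevenue π0 πB)) ∧
    -- every maximizer of the simultaneous-investment payoff maximizes the follower payoff
    (∀ τ : InvestmentTiming.StopTime 𝓕,
      InvestmentTiming.Attains P θ (InvestmentTiming.simultaneousPayoff P π0 πB) τ →
      InvestmentTiming.Attains P θ (InvestmentTiming.followerPayoff P π0 πF πB) τ) ∧
    -- the follower reaction to a maximizer of the follower payoff exists and maximizes the
    -- simultaneous-investment payoff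
    (∀ τ : InvestmentTiming.StopTime 𝓕,
      InvestmentTiming.Attains P θ (InvestmentTiming.followerPayoff P π0 πF πB) τ →
      (∃ σ, InvestmentTiming.IsFollowerReaction P πF πB τ σ) ∧
      ∀ σ, InvestmentTiming.IsFollowerReaction P πF πB τ σ →
        InvestmentTiming.Attains P θ (InvestmentTiming.simultaneousPayoff P π0 πB) σ) ∧
    -- both problems have a latest solution, and these agree
    (∃ τ : InvestmentTiming.StopTime 𝓕,
      InvestmentTiming.IsLatestSolution P θ (InvestmentTiming.simultaneousPayoff P π0 πB) τ ∧
      InvestmentTiming.IsLatestSolution P θ (InvestmentTiming.followerPayoff P π0 πF πB) τ) ∧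
    (∀ τ : InvestmentTiming.StopTime 𝓕,
      InvestmentTiming.IsLatestSolution P θ (InvestmentTiming.simultaneousPayoff P π0 πB) τ ↔
      InvestmentTiming.IsLatestSolution P θ (InvestmentTiming.followerPayoff P π0 πF πB) τ) := by
  open InvestmentTiming in
  have hX : ∀ τ : StopTime 𝓕, θ.1 ≤ᵐ[P] τ.1 →
      P[simultaneousPayoff P π0 πB τ | θ.2.measurableSpace] =ᵐ[P]
        P[fun ω => accrued (π0 - πB) (fun _ => 0) τ.1 ω +
          accrued πB (fun _ => 0) (fun _ => ⊤) ω | θ.2.measurableSpace] := fun τ hτ =>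
    (condExp_simultaneousPayoff hcomplete h0 hB hτ).trans
      (condExp_congr_ae (simultaneousRevenue_ae_eq h0 hB τ))
  have hdiff := InvestmentTiming.integrable_sub_process h0 hB
  have hR := hB.integrable_accrued (a := fun _ => 0) (b := fun _ => ⊤)
    measurable_const measurable_const
  obtain ⟨τS, hτS, hτSlatest⟩ :=
    InvestmentTiming.exists_isLatestSolution hcomplete hdiff hR hX
  have hSF : ∀ τ : InvestmentTiming.StopTime 𝓕,
      InvestmentTiming.Attains P θ (InvestmentTiming.simultaneousPayoff P π0 πB) τ →
      InvestmentTiming.Attains P θ (InvestmentTiming.followerPayoff P π0 πF πB) τ := fun τ hτ =>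
    hτ.followerPayoff_of_simultaneousPayoff hcomplete h0 hF hB hF0
  have hτF : InvestmentTiming.IsLatestSolution P θ
      (InvestmentTiming.followerPayoff P π0 πF πB) τS := by
    refine ⟨hSF τS hτS, fun σ hσ => ?_⟩
    obtain ⟨ρ, hρ, -⟩ := InvestmentTiming.exists_isFollowerReaction hcomplete hF hB σ
    -- A solution `σ` of (F) precedes its reaction `ρ`, which solves (S) and so precedes `τS`.
    exact hρ.1.trans (hτSlatest ρ
      (hσ.simultaneousPayoff_of_followerPayoff hcomplete h0 hF hB hF0 hρ))
  refine ⟨?_, hSF, fun τ hτ => ⟨InvestmentTiming.exists_isFollowerReaction hcomplete hF hB τ,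
    fun σ hσ => hτ.simultaneousPayoff_of_followerPayoff hcomplete h0 hF hB hF0 hσ.1⟩,
    ⟨τS, ⟨hτS, hτSlatest⟩, hτF⟩, fun τ => ⟨fun hτ => ⟨hSF τ hτ.1, fun σ hσ => ?_⟩, fun hτ => ?_⟩⟩
  · have hrev : InvestmentTiming.Attains P θ
        (InvestmentTiming.simultaneousRevenue π0 πB) τS := by
      rw [InvestmentTiming.attains_iff_maximizes hcomplete hdiff hR fun τ _ =>
        condExp_congr_ae (InvestmentTiming.simultaneousRevenue_ae_eq h0 hB τ)]
      exact (InvestmentTiming.attains_iff_maximizes hcomplete hdiff hR hX τS).1 hτS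
    exact hτS.2.familyEssSup_ae_eq.trans
      ((InvestmentTiming.condExp_simultaneousPayoff hcomplete h0 hB hτS.1).trans
        hrev.2.familyEssSup_ae_eq.symm)
  · exact (hτF.2 σ hσ).trans (hτ.2 τS hτS)
  -- Latest solutions are unique only up to null sets, so attainment of (S) has to be carried from
  -- `τS` to `τ`.
  · have heq : τS.1 =ᵐ[P] τ.1 := (hτ.2 τS hτF.1).antisymm (hτF.2 τ hτ.1)
    exact ⟨hτS.congr_ae hcomplete hdiff hR hX heq,
      fun σ hσ => (hτSlatest σ hσ).trans heq.le⟩
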